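/- Let $d,m\in\mathbb{N}_0$, let $A$ be a real $d\times d$ matrix, $\delta\in\mathbb{R}$, $\theta$ a probability measure on $\mathbb{R}^m$, and $f:\mathbb{R}^d\times\mathcal{P}(\mathbb{R}^d)\times\mathbb{R}^m\to\mathbb{R}^d$ a measurable function, where $\mathcal{P}(\mathbb{R}^d)$ is the space of Borel probability measures on $\mathbb{R}^d$ with the Borel $\sigma$-field of the weak topology. Let $\mathcal{P}_1(\mathbb{R}^d)$ be the set of $\mu\in\mathcal{P}(\mathbb{R}^d)$ with $\int|x|\,\mu(dx)<\infty$, and let $\mathcal{W}_1(\mu,\nu)=\inf E|X-Y|$ be the Wasserstein-1 distance, the infimum being over all pairs of random variables $(X,Y)$ on a common probability space with $X\sim\mu$, $Y\sim\nu$. Let $$D(z)=\sup_{x_1\ne x_2\in\mathbb{R}^d,\ \mu_1\neq\mu_2\in\mathcal{P}_1(\mathbb{R}^d)}\frac{|f(x_1,\mu_1,z)-f(x_2,\mu_2,z)|}{|x_1-x_2|+\mathcal{W}_1(\mu_1,\mu_2)},\qquad D_1(z)=|f(0,\delta_0,z)|,\qquad z\in\mathbb{R}^m .$$ Let $\mu_0\in\mathcal{P}_1(\mathbb{R}^d)$.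 For every $N\ge1$ let, on some probability space (which may depend on $N$), $X_0^{1},\dots,X_0^{N}$ be exchangeable $\mathbb{R}^d$-valued random variables with common distribution $\mu_0$, and let $\{\epsilon_n^i : 1\le i\le N,\ n\ge1\}$ be i.i.d. $\mathbb{R}^m$-valued random variables with law $\theta$, independent of $(X_0^1,\dots,X_0^N)$. Define $$X_{n+1}^i=AX_n^i+\delta f(X_n^i,\mu_n^N,\epsilon_{n+1}^i),\qquad \mu_n^N=\frac1N\sum_{i=1}^N\delta_{X_n^i},\qquad 1\le i\le N,\ n\ge0 .$$ Define also $\mu_{n+1}=\mu_nP^{\mu_n}$ for $n\ge0$, where $P^\rho(x,C)=\theta\{z: Ax+\delta f(x,\rho,z)\in C\}$ for Borel $C\subset\mathbb{R}^d$; that is, $\mu_n$ is the law at time $n$ of the nonlinear Markov chain $X_{n+1}=AX_n+\delta f(X_n,\mu_n,\epsilon_{n+1})$, $\mathcal{L}(X_n)=\mu_n$. Suppose that $\int D\,d\theta<\infty$ and $\int D_1\,d\theta<\infty$, and that $E\,\mathcal{W}_1(\mu_0^N,\mu_0)\to0$ as $N\to\infty$. Then, for every $n\ge0$, $E\,\mathcal{W}_1(\mu_n^N,\mu_n)\to0$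 as $N\to\infty$. -/

import Mathlib

open MeasureTheory ProbabilityTheory Filter Topology
open scoped ENNReal

namespace WeaklyInteracting

/-- `ℝ^d` with the Euclidean norm. -/
abbrev E (d : ℕ) : Type := EuclideanSpace ℝ (Fin d)

/-- `μ ∈ 𝒫₁(ℝ^d)`, i.e. `∫ |x| μ(dx) < ∞`. -/
def HasFirstMoment {d : ℕ} (μ : ProbabilityMeasure (E d)) : Prop :=
  ∫⁻ x, ‖x‖ₑ ∂(μ : Measure (E d)) < ∞

/-- The Wasserstein-1 distance: the infimum of `E|X - Y|` over all pairs of random variables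
`(X, Y)` with marginals `μ` and `ν`, written through the joint law `π` of `(X, Y)`. -/
noncomputable def W1 {d : ℕ} (μ ν : ProbabilityMeasure (E d)) : ℝ≥0∞ :=
  ⨅ (π : Measure (E d × E d)) (_ : π.map Prod.fst = μ) (_ : π.map Prod.snd = ν),
    ∫⁻ p, ‖p.1 - p.2‖ₑ ∂π

/-- The data of the model: a `d × d` matrix `A`, a real parameter `δ`, a measurable
`f : ℝ^d × 𝒫(ℝ^d) × ℝ^m → ℝ^d`, and the law `θ` of the noise on `ℝ^m`.
The σ-algebra on `𝒫(ℝ^d)` is the one generated by the evaluations `μ ↦ μ C`, which is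
the Borel σ-algebra of the topology of weak convergence. -/
structure Model (d m : ℕ) where
  A : Matrix (Fin d) (Fin d) ℝ
  δ : ℝ
  f : E d → ProbabilityMeasure (E d) → E m → E d
  measurable_f : Measurable fun p : E d × ProbabilityMeasure (E d) × E m => f p.1 p.2.1 p.2.2
  θ : ProbabilityMeasure (E m)

/-- The empirical measure `(1/N) ∑ᵢ δ_{xᵢ}`. -/
noncomputable def empirical {d : ℕ} {N : ℕ+} (x : Fin N → E d) : ProbabilityMeasure (E d) :=
  ⟨((N : ℕ) : ℝ≥0∞)⁻¹ • ∑ i, Measure.dirac (x i), ⟨by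
    simp [ENNReal.inv_mul_cancel]⟩⟩

/-- A finite family of random variables is exchangeable if its joint law is invariant under
all permutations of the indices. -/
def Exchangeable {Ω S : Type*} [MeasurableSpace Ω] [MeasurableSpace S] {N : ℕ}
    (Y : Fin N → Ω → S) (P : Measure Ω) : Prop :=
  ∀ π : Equiv.Perm (Fin N),
    P.map (fun ω i => Y (π i) ω) = P.map (fun ω i => Y i ω)

namespace Model

variable {d m : ℕ} (M : Model d m)

/-- One step of the dynamics: `A x + δ f(x, ρ, z)`. -/
noncomputable def step (x : E d) (ρ : ProbabilityMeasure (E d)) (z : E m) : E d :=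
  Matrix.toEuclideanCLM (𝕜 := ℝ) M.A x + M.δ • M.f x ρ z

theorem measurable_step (ρ : ProbabilityMeasure (E d)) :
    Measurable fun p : E d × E m => M.step p.1 ρ p.2 := by
  have h : Measurable fun p : E d × E m => M.f p.1 ρ p.2 :=
    M.measurable_f.comp (by fun_prop : Measurable fun p : E d × E m => (p.1, ρ, p.2))
  unfold step
  fun_prop

theorem measurable_step_right (x : E d) (ρ : ProbabilityMeasure (E d)) :
    Measurable fun z : E m => M.step x ρ z := by
  have h : Measurable fun z : E m => M.f x ρ z :=
    M.measurable_f.comp (by fun_prop : Measurable fun z : E m => (x, ρ, z))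
  unfold step
  fun_prop

theorem measurable_map_step (ρ : ProbabilityMeasure (E d)) :
    Measurable fun x : E d => (M.θ : Measure (E m)).map (fun z => M.step x ρ z) := by
  refine Measure.measurable_of_measurable_coe _ fun C hC => ?_
  have h' : (fun x : E d => ((M.θ : Measure (E m)).map (fun z => M.step x ρ z)) C) =
      fun x : E d => (M.θ : Measure (E m))
        (Prod.mk x ⁻¹' ((fun p : E d × E m => M.step p.1 ρ p.2) ⁻¹' C)) := by
    funext x
    rw [Measure.map_apply (M.measurable_step_right x ρ) hC]
    rfl
  rw [h']
  exact measurable_measure_prodMk_left (M.measurable_step ρ hC)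

/-- The transition kernel `P^ρ(x, C) = θ {z | A x + δ f(x, ρ, z) ∈ C}`. -/
noncomputable def kernel (ρ : ProbabilityMeasure (E d)) : Kernel (E d) (E d) :=
  ⟨fun x => (M.θ : Measure (E m)).map (fun z => M.step x ρ z), M.measurable_map_step ρ⟩

instance isMarkovKernel_kernel (ρ : ProbabilityMeasure (E d)) : IsMarkovKernel (M.kernel ρ) where
  isProbabilityMeasure x :=
    Measure.isProbabilityMeasure_map (M.measurable_step_right x ρ).aemeasurable

/-- `Ψ(μ) = μ P^μ`. -/
noncomputable def Psi (μ : ProbabilityMeasure (E d)) : ProbabilityMeasure (E d) :=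
  ⟨(μ : Measure (E d)).bind (M.kernel μ), inferInstance⟩

/-- The law `μ_n` of the nonlinear Markov chain: `μ_{n+1} = Ψ(μ_n)`, started at `μ₀`. -/
noncomputable def law (μ₀ : ProbabilityMeasure (E d)) : ℕ → ProbabilityMeasure (E d)
  | 0 => μ₀
  | n + 1 => M.Psi (law μ₀ n)

/-- The `N`-particle system with initial positions `x` and noise `e`:
`X_{n+1}^i = A X_n^i + δ f(X_n^i, μ_n^N, ε_{n+1}^i)`, where `e n i` stands for `ε_{n+1}^i`. -/
noncomputable def particles {N : ℕ+} (x : Fin N → E d) (e : ℕ → Fin N → E m) :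
    ℕ → Fin N → E d
  | 0 => x
  | n + 1 => fun i => M.step (particles x e n i) (empirical (particles x e n)) (e n i)

/-- The Lipschitz constant `D(z)` of `f(·, ·, z)` on `ℝ^d × 𝒫₁(ℝ^d)`, in `[0, ∞]`. -/
noncomputable def D (z : E m) : ℝ≥0∞ :=
  ⨆ (x₁ : E d) (x₂ : E d) (μ₁ : ProbabilityMeasure (E d)) (μ₂ : ProbabilityMeasure (E d))
    (_ : x₁ ≠ x₂) (_ : μ₁ ≠ μ₂) (_ : HasFirstMoment μ₁) (_ : HasFirstMoment μ₂),
    ‖M.f x₁ μ₁ z - M.f x₂ μ₂ z‖ₑ / (‖x₁ - x₂‖ₑ + W1 μ₁ μ₂)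

/-- `D₁(z) = |f(0, δ₀, z)|`. -/
noncomputable def D₁ (z : E m) : ℝ≥0∞ :=
  ‖M.f 0 (diracProba 0) z‖ₑ

/-- `∫ D(z) θ(dz) < ∞`; that the integral is meaningful includes measurability of `D`
with respect to the completion of `θ`. -/
def AssumptionA : Prop :=
  AEMeasurable M.D (M.θ : Measure (E m)) ∧ ∫⁻ z, M.D z ∂(M.θ : Measure (E m)) < ∞

/-- `∫ D₁(z) θ(dz) < ∞`. -/
def AssumptionB : Prop :=
  ∫⁻ z, M.D₁ z ∂(M.θ : Measure (E m)) < ∞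

end Model

end WeaklyInteracting

open WeaklyInteracting

/-! ### The Wasserstein-1 distance. -/

namespace WeaklyInteracting

variable {d : ℕ}

/-! The proof is an induction on time; each step rests on a one-step estimate from a deterministic
configuration `x` (`AssumptionA.lintegral_W1_step_le`). Write `ν` for the limit law at time `n`, `L`
for `lipConst` and `W` for the distance from the empirical measure of `x` to `ν`.

The new empirical measure is compared with `Psi ν` through two intermediate measures. Replacing the
measure argument of `f` by `ν` moves the particles by at most `L * W` on average, because `f` is
Lipschitz with integrable constant. The resulting random empirical measure fluctuates around its
mean, the image of the old empirical measure under `P^ν`. That mean is within `L * W` of `Psi ν`, as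
`P^ν` is `L`-Lipschitz for `W1` (`AssumptionA.W1_push_le`).

The fluctuation is a law of large numbers for independent, non-identically distributed points having
only a first moment. A finite quantizer `q` reduces it to the masses of finitely many cells
(`W1_le_quantization`), whose deviations are of order `N^(-1/2)` by a variance bound. The
quantization error `‖x - q x‖` is a 1-Lipschitz function, so its integrals against the random
measures are controlled by its integral against the fixed law `Psi ν` plus `L * W`; no uniform
integrability argument is needed.

The noise at each step is independent of the current state, so the estimate integrates to a
recursion: the expected distance is multiplied by at most `4 * L`, with an additive error made small
by choosing `q` first and then `N` large. -/

theorem W1_le_of_coupling {μ ν : ProbabilityMeasure (E d)} (π : Measure (E d × E d))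
    (h₁ : π.map Prod.fst = μ) (h₂ : π.map Prod.snd = ν) :
    W1 μ ν ≤ ∫⁻ p, ‖p.1 - p.2‖ₑ ∂π :=
  (iInf_le _ π).trans ((iInf_le _ h₁).trans (iInf_le _ h₂))

theorem le_W1 {μ ν : ProbabilityMeasure (E d)} {c : ℝ≥0∞}
    (h : ∀ π : Measure (E d × E d), π.map Prod.fst = μ → π.map Prod.snd = ν →
      c ≤ ∫⁻ p, ‖p.1 - p.2‖ₑ ∂π) : c ≤ W1 μ ν :=
  le_iInf fun π => le_iInf fun h₁ => le_iInf fun h₂ => h π h₁ h₂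

theorem measurable_enorm_sub :
    Measurable fun p : E d × E d => ‖p.1 - p.2‖ₑ := by fun_prop

theorem W1_le_lintegral {Ω : Type*} [MeasurableSpace Ω] {P : Measure Ω}
    {μ ν : ProbabilityMeasure (E d)} {X Y : Ω → E d} (hX : Measurable X) (hY : Measurable Y)
    (h₁ : P.map X = μ) (h₂ : P.map Y = ν) :
    W1 μ ν ≤ ∫⁻ ω, ‖X ω - Y ω‖ₑ ∂P := by
  refine (W1_le_of_coupling (P.map fun ω => (X ω, Y ω)) ?_ ?_).trans_eq ?_
  · rw [Measure.map_map measurable_fst (hX.prodMk hY)]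
    exact h₁
  · rw [Measure.map_map measurable_snd (hX.prodMk hY)]
    exact h₂
  · rw [lintegral_map measurable_enorm_sub (hX.prodMk hY)]

theorem isProbabilityMeasure_coupling {μ : ProbabilityMeasure (E d)} {π : Measure (E d × E d)}
    (h₁ : π.map Prod.fst = μ) : IsProbabilityMeasure π := by
  constructor
  have h : (π.map Prod.fst) Set.univ = 1 := by rw [h₁]; exact measure_univ
  rwa [Measure.map_apply measurable_fst MeasurableSet.univ, Set.preimage_univ] at h

/-- Two couplings with a common marginal can be glued. -/
theorem W1_triangle (μ₁ μ₂ μ₃ : ProbabilityMeasure (E d)) :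
    W1 μ₁ μ₃ ≤ W1 μ₁ μ₂ + W1 μ₂ μ₃ := by
  have key : ∀ π₁₂ : Measure (E d × E d), π₁₂.map Prod.fst = μ₁ → π₁₂.map Prod.snd = μ₂ →
      ∀ π₂₃ : Measure (E d × E d), π₂₃.map Prod.fst = μ₂ → π₂₃.map Prod.snd = μ₃ →
      W1 μ₁ μ₃ ≤ ∫⁻ p, ‖p.1 - p.2‖ₑ ∂π₁₂ + ∫⁻ p, ‖p.1 - p.2‖ₑ ∂π₂₃ := by
    intro π₁₂ h₁ h₂ π₂₃ h₂' h₃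
    have := isProbabilityMeasure_coupling h₁
    have := isProbabilityMeasure_coupling h₂'
    have hs : IsProbabilityMeasure (π₁₂.map Prod.swap) :=
      Measure.isProbabilityMeasure_map measurable_swap.aemeasurable
    set ρ := π₁₂.map Prod.swap with hρ
    have hfst : ρ.fst = μ₂ := by
      rw [Measure.fst, hρ, Measure.map_map measurable_fst measurable_swap]
      exact h₂
    have hdis : (μ₂ : Measure (E d)) ⊗ₘ ρ.condKernel = ρ := by
      rw [← hfst]
      exact ρ.disintegrate ρ.condKernel
    -- The third coordinate is drawn from the conditional law of the first marginal given the shared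
    -- middle point, so the coordinates of `Λ` are (middle, last, first).
    set Λ : Measure ((E d × E d) × E d) := π₂₃ ⊗ₘ (ρ.condKernel.comap Prod.fst measurable_fst)
      with hΛ
    have hm : Measurable fun p : (E d × E d) × E d => (p.1.1, p.2) := by fun_prop
    have h21 : Λ.map (fun p => (p.1.1, p.2)) = ρ := by
      rw [← hdis]
      refine Measure.ext_of_lintegral _ fun g hg => ?_
      rw [lintegral_map hg hm, hΛ, Measure.lintegral_compProd
          (by fun_prop : Measurable fun p : (E d × E d) × E d => g (p.1.1, p.2)),
        Measure.lintegral_compProd hg, ← h₂', lintegral_map _ measurable_fst]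
      · rfl
      · exact hg.lintegral_kernel_prod_right'
    have h23 : Λ.map Prod.fst = π₂₃ := Measure.fst_compProd _ _
    have hX : Λ.map Prod.snd = μ₁ := by
      have : Λ.map Prod.snd = ρ.map Prod.snd := by
        rw [← h21, Measure.map_map measurable_snd hm]; rfl
      rw [this, hρ, Measure.map_map measurable_snd measurable_swap]
      exact h₁
    have hY : Λ.map (fun p => p.1.2) = μ₃ := by
      rw [← h₃, ← h23, Measure.map_map measurable_snd measurable_fst]; rfl
    refine (W1_le_lintegral (by fun_prop) (by fun_prop) hX hY).trans ?_
    calc ∫⁻ p, ‖p.2 - p.1.2‖ₑ ∂Λ ≤ ∫⁻ p, (‖p.2 - p.1.1‖ₑ + ‖p.1.1 - p.1.2‖ₑ) ∂Λ := by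
          refine lintegral_mono fun p => ?_
          rw [← sub_add_sub_cancel p.2 p.1.1 p.1.2]
          exact enorm_add_le _ _
      _ = ∫⁻ p, ‖p.2 - p.1.1‖ₑ ∂Λ + ∫⁻ p, ‖p.1.1 - p.1.2‖ₑ ∂Λ :=
          lintegral_add_left (by fun_prop) _
      _ = _ := by
          congr 1
          · have e1 : ∫⁻ p, ‖p.2 - p.1.1‖ₑ ∂Λ = ∫⁻ p, ‖p.2 - p.1‖ₑ ∂ρ := by
              rw [← h21, lintegral_map (by fun_prop) hm]
            rw [e1, hρ, lintegral_map (by fun_prop) measurable_swap]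
            rfl
          · rw [← h23, lintegral_map (by fun_prop) measurable_fst]
  simp only [W1, ENNReal.iInf_add, ENNReal.add_iInf]
  refine le_iInf fun π₂₃ => le_iInf fun h₂' => le_iInf fun h₃ => ?_
  refine le_iInf fun π₁₂ => le_iInf fun h₁ => le_iInf fun h₂ => ?_
  exact key π₁₂ h₁ h₂ π₂₃ h₂' h₃

theorem W1_le_swap (μ ν : ProbabilityMeasure (E d)) : W1 μ ν ≤ W1 ν μ := by
  refine le_W1 fun π h₁ h₂ => ?_
  refine (W1_le_lintegral measurable_snd measurable_fst h₂ h₁).trans_eq ?_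
  exact lintegral_congr fun p => enorm_sub_rev _ _

theorem W1_comm (μ ν : ProbabilityMeasure (E d)) : W1 μ ν = W1 ν μ :=
  le_antisymm (W1_le_swap μ ν) (W1_le_swap ν μ)

theorem W1_le_add_moments (μ ν : ProbabilityMeasure (E d)) :
    W1 μ ν ≤ ∫⁻ x, ‖x‖ₑ ∂(μ : Measure (E d)) + ∫⁻ x, ‖x‖ₑ ∂(ν : Measure (E d)) := by
  have h₁ : ((μ : Measure (E d)).prod (ν : Measure (E d))).map Prod.fst = μ :=
    Measure.fst_prod
  have h₂ : ((μ : Measure (E d)).prod (ν : Measure (E d))).map Prod.snd = ν :=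
    Measure.snd_prod
  refine (W1_le_of_coupling _ h₁ h₂).trans ?_
  calc _ ≤ ∫⁻ p : E d × E d, (‖p.1‖ₑ + ‖p.2‖ₑ)
          ∂((μ : Measure (E d)).prod (ν : Measure (E d))) :=
        lintegral_mono fun p => enorm_sub_le
    _ = _ := by
        rw [lintegral_add_left (by fun_prop)]
        congr 1
        · conv_rhs => rw [← h₁, lintegral_map (by fun_prop) measurable_fst]
        · conv_rhs => rw [← h₂, lintegral_map (by fun_prop) measurable_snd]

theorem W1_lt_top {μ ν : ProbabilityMeasure (E d)} (hμ : HasFirstMoment μ)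
    (hν : HasFirstMoment ν) : W1 μ ν < ∞ :=
  (W1_le_add_moments μ ν).trans_lt (ENNReal.add_lt_top.2 ⟨hμ, hν⟩)

theorem hasFirstMoment_diracProba (x : E d) : HasFirstMoment (diracProba x) := by
  simp [HasFirstMoment, diracProba]

/-- Integrals of functions that are Lipschitz with constant one are controlled by `W1`. -/
theorem lintegral_le_lintegral_add_W1 (μ ν : ProbabilityMeasure (E d)) {g : E d → ℝ≥0∞}
    (hg : Measurable g) (hlip : ∀ x y, g x ≤ g y + ‖x - y‖ₑ) :
    ∫⁻ x, g x ∂(μ : Measure (E d)) ≤ ∫⁻ x, g x ∂(ν : Measure (E d)) + W1 μ ν := by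
  simp only [W1, ENNReal.add_iInf]
  refine le_iInf fun π => le_iInf fun h₁ => le_iInf fun h₂ => ?_
  rw [← h₁, ← h₂, lintegral_map hg measurable_fst, lintegral_map hg measurable_snd,
    ← lintegral_add_left (by fun_prop)]
  exact lintegral_mono fun p => hlip _ _

/-! ### Empirical measures. -/

section Empirical

variable {N : ℕ+}

theorem coe_empirical (x : Fin N → E d) : (empirical x : Measure (E d)) =
    ((N : ℕ) : ℝ≥0∞)⁻¹ • ∑ i, Measure.dirac (x i) := rfl

theorem lintegral_empirical (x : Fin N → E d) {g : E d → ℝ≥0∞} (hg : Measurable g) :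
    ∫⁻ y, g y ∂(empirical x : Measure (E d)) = ((N : ℕ) : ℝ≥0∞)⁻¹ * ∑ i, g (x i) := by
  rw [coe_empirical, lintegral_smul_measure, lintegral_finsetSum_measure, smul_eq_mul]
  congr 1
  exact Finset.sum_congr rfl fun i _ => lintegral_dirac' _ hg

theorem empirical_apply (x : Fin N → E d) {s : Set (E d)} (hs : MeasurableSet s) :
    (empirical x : Measure (E d)) s =
      ((N : ℕ) : ℝ≥0∞)⁻¹ * ∑ i, s.indicator (fun _ => (1 : ℝ≥0∞)) (x i) := by
  rw [← lintegral_indicator_one hs]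
  exact lintegral_empirical x (measurable_one.indicator hs)

theorem inv_coe_ne_top : ((N : ℕ) : ℝ≥0∞)⁻¹ ≠ ∞ := by simp

theorem hasFirstMoment_empirical (x : Fin N → E d) : HasFirstMoment (empirical x) := by
  rw [HasFirstMoment, lintegral_empirical x measurable_enorm]
  exact ENNReal.mul_lt_top inv_coe_ne_top.lt_top (ENNReal.sum_lt_top.2 fun i _ => enorm_lt_top)

theorem W1_empirical_le (x y : Fin N → E d) :
    W1 (empirical x) (empirical y) ≤ ((N : ℕ) : ℝ≥0∞)⁻¹ * ∑ i, ‖x i - y i‖ₑ := by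
  refine (W1_le_of_coupling
    (((N : ℕ) : ℝ≥0∞)⁻¹ • ∑ i, Measure.dirac (x i, y i)) ?_ ?_).trans_eq ?_
  · rw [coe_empirical, Measure.map_smul, Measure.map_finset_sum measurable_fst.aemeasurable]
    simp [Measure.map_dirac' measurable_fst]
  · rw [coe_empirical, Measure.map_smul, Measure.map_finset_sum measurable_snd.aemeasurable]
    simp [Measure.map_dirac' measurable_snd]
  · rw [lintegral_smul_measure, lintegral_finsetSum_measure, smul_eq_mul]
    congr 1
    exact Finset.sum_congr rfl fun i _ => lintegral_dirac' _ measurable_enorm_sub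

/-- The triangle inequality squeezes the values near `x` between two functions with the same limit.
This supplies the measurability required by Tonelli without any study of `W1` on the whole space of
measures. -/
theorem continuous_W1_empirical {ν : ProbabilityMeasure (E d)} (hν : HasFirstMoment ν) :
    Continuous fun x : Fin N → E d => W1 (empirical x) ν := by
  rw [continuous_iff_continuousAt]
  intro x
  have hb : Tendsto (fun y : Fin N → E d => ((N : ℕ) : ℝ≥0∞)⁻¹ * ∑ i, ‖y i - x i‖ₑ)
      (𝓝 x) (𝓝 0) := by
    have hc : Continuous fun y : Fin N → E d => ∑ i, ‖y i - x i‖ₑ := by fun_prop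
    have := ENNReal.Tendsto.const_mul (hc.tendsto x) (Or.inr (inv_coe_ne_top (N := N)))
    simpa using this
  have hx : W1 (empirical x) ν ≠ ∞ := (W1_lt_top (hasFirstMoment_empirical x) hν).ne
  refine tendsto_of_tendsto_of_tendsto_of_le_of_le
    (g := fun y => W1 (empirical x) ν - ((N : ℕ) : ℝ≥0∞)⁻¹ * ∑ i, ‖y i - x i‖ₑ)
    (h := fun y => W1 (empirical x) ν + ((N : ℕ) : ℝ≥0∞)⁻¹ * ∑ i, ‖y i - x i‖ₑ) ?_ ?_ ?_ ?_
  · simpa using ENNReal.Tendsto.sub tendsto_const_nhds hb (Or.inl hx)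
  · simpa using tendsto_const_nhds.add hb
  · intro y
    refine tsub_le_iff_left.2 ((W1_triangle _ (empirical y) _).trans ?_)
    rw [W1_comm (empirical x)]
    exact add_le_add (W1_empirical_le y x) le_rfl
  · intro y
    refine (W1_triangle _ (empirical x) _).trans ?_
    rw [add_comm]
    exact add_le_add le_rfl (W1_empirical_le y x)

theorem measurable_W1_empirical {ν : ProbabilityMeasure (E d)} (hν : HasFirstMoment ν) :
    Measurable fun x : Fin N → E d => W1 (empirical x) ν :=
  (continuous_W1_empirical hν).measurable

theorem measurable_empirical : Measurable (empirical : (Fin N → E d) → ProbabilityMeasure (E d)) := by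
  refine Measurable.subtype_mk (Measure.measurable_of_measurable_coe _ fun s hs => ?_)
  have : ∀ x : Fin N → E d, (((N : ℕ) : ℝ≥0∞)⁻¹ • ∑ i, Measure.dirac (x i)) s =
      ((N : ℕ) : ℝ≥0∞)⁻¹ * ∑ i, s.indicator (fun _ => (1 : ℝ≥0∞)) (x i) :=
    fun x => empirical_apply x hs
  simp only [this]
  refine Measurable.const_mul (Finset.measurable_sum _ fun i _ => ?_) _
  exact (measurable_const.indicator hs).comp (measurable_pi_apply i)

end Empirical

end WeaklyInteracting

/-! ### Lipschitz estimates for one step of the dynamics. -/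

namespace WeaklyInteracting

variable {d : ℕ}

/-- A nonzero finite constant passes through the nested infima; for `C = 0` the value `∞` attached
to a measure that is not a coupling would be turned into `0`. -/
theorem le_mul_W1 {μ ν : ProbabilityMeasure (E d)} {c C : ℝ≥0∞} (hC₀ : C ≠ 0) (hC : C ≠ ∞)
    (h : ∀ π : Measure (E d × E d), π.map Prod.fst = μ → π.map Prod.snd = ν →
      c ≤ C * ∫⁻ p, ‖p.1 - p.2‖ₑ ∂π) : c ≤ C * W1 μ ν := by
  simp only [W1, ENNReal.mul_iInf_of_ne hC₀ hC]
  exact le_iInf fun π => le_iInf fun h₁ => le_iInf fun h₂ => h π h₁ h₂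

theorem W1_self (μ : ProbabilityMeasure (E d)) : W1 μ μ = 0 := by
  have h := W1_le_lintegral (P := (μ : Measure (E d))) (μ := μ) (ν := μ) measurable_id
    measurable_id Measure.map_id Measure.map_id
  simpa using h

/-- The translate of a probability measure by a vector. -/
noncomputable def translate (μ : ProbabilityMeasure (E d)) (v : E d) :
    ProbabilityMeasure (E d) :=
  μ.map (f := fun x => x + v) (by fun_prop)

theorem coe_translate (μ : ProbabilityMeasure (E d)) (v : E d) :
    (translate μ v : Measure (E d)) = (μ : Measure (E d)).map (fun x => x + v) := rfl

theorem W1_translate_le (μ : ProbabilityMeasure (E d)) (v : E d) :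
    W1 μ (translate μ v) ≤ ‖v‖ₑ := by
  refine (W1_le_lintegral (P := (μ : Measure (E d))) measurable_id
    (measurable_id.add_const v) Measure.map_id rfl).trans_eq ?_
  simp

theorem HasFirstMoment.translate {μ : ProbabilityMeasure (E d)} (hμ : HasFirstMoment μ)
    (v : E d) : HasFirstMoment (translate μ v) := by
  have h := lintegral_le_lintegral_add_W1 (WeaklyInteracting.translate μ v) μ (g := fun x => ‖x‖ₑ)
    (by fun_prop) (fun x y => by
      calc ‖x‖ₑ = ‖y + (x - y)‖ₑ := by rw [add_sub_cancel]
        _ ≤ _ := enorm_add_le _ _)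
  refine h.trans_lt (ENNReal.add_lt_top.2 ⟨hμ, ?_⟩)
  rw [W1_comm]
  exact (W1_translate_le μ v).trans_lt enorm_lt_top

theorem HasFirstMoment.integrable {μ : ProbabilityMeasure (E d)} (hμ : HasFirstMoment μ) :
    Integrable (fun x : E d => x) (μ : Measure (E d)) :=
  ⟨aestronglyMeasurable_id, hμ⟩

/-- The mean serves as an invariant that tells a translate apart from other measures. -/
theorem integral_translate {μ : ProbabilityMeasure (E d)} (hμ : HasFirstMoment μ) (v : E d) :
    ∫ x, x ∂(translate μ v : Measure (E d)) = ∫ x, x ∂(μ : Measure (E d)) + v := by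
  rw [coe_translate, integral_map (f := fun x : E d => x) (by fun_prop) aestronglyMeasurable_id,
    integral_add hμ.integrable (integrable_const v)]
  simp

namespace Model

variable {m : ℕ} (M : Model d m)

theorem enorm_f_sub_le_of_ne {x₁ x₂ : E d} {μ₁ μ₂ : ProbabilityMeasure (E d)} (hx : x₁ ≠ x₂)
    (hμ : μ₁ ≠ μ₂) (h₁ : HasFirstMoment μ₁) (h₂ : HasFirstMoment μ₂) (z : E m) :
    ‖M.f x₁ μ₁ z - M.f x₂ μ₂ z‖ₑ ≤ M.D z * (‖x₁ - x₂‖ₑ + W1 μ₁ μ₂) := by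
  rw [← ENNReal.div_le_iff]
  · refine le_trans ?_ (le_iSup _ x₁)
    refine le_trans ?_ (le_iSup _ x₂)
    refine le_trans ?_ (le_iSup _ μ₁)
    refine le_trans ?_ (le_iSup _ μ₂)
    refine le_trans ?_ (le_iSup _ hx)
    refine le_trans ?_ (le_iSup _ hμ)
    refine le_trans ?_ (le_iSup _ h₁)
    exact le_iSup_of_le h₂ le_rfl
  · simp [sub_ne_zero.2 hx]
  · exact (ENNReal.add_lt_top.2 ⟨enorm_lt_top, W1_lt_top h₁ h₂⟩).ne

/-- The Lipschitz bound extends to coinciding points or measures, by perturbing both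
by a small translation. -/
theorem enorm_f_sub_le {z : E m} (hz : M.D z ≠ ∞) (x₁ x₂ : E d)
    {μ₁ μ₂ : ProbabilityMeasure (E d)} (h₁ : HasFirstMoment μ₁) (h₂ : HasFirstMoment μ₂) :
    ‖M.f x₁ μ₁ z - M.f x₂ μ₂ z‖ₑ ≤ M.D z * (‖x₁ - x₂‖ₑ + W1 μ₁ μ₂) := by
  rcases Nat.eq_zero_or_pos d with rfl | hd
  · rw [Subsingleton.elim (M.f x₁ μ₁ z) (M.f x₂ μ₂ z)]
    simp
  have : Nonempty (Fin d) := ⟨⟨0, hd⟩⟩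
  have : Nontrivial (E d) := inferInstance
  have key : ∀ r : ℝ≥0∞, 0 < r → ‖M.f x₁ μ₁ z - M.f x₂ μ₂ z‖ₑ ≤
      M.D z * (‖x₁ - x₂‖ₑ + W1 μ₁ μ₂ + 4 * r) := by
    intro r hr
    have hinf : (Metric.eball (0 : E d) r).Infinite :=
      infinite_of_mem_nhds (0 : E d) (Metric.eball_mem_nhds _ hr)
    -- The three excluded vectors are exactly those for which one leg of the path from `(x₁, μ₁)`
    -- through `(x₁ + v, μ₃)` to `(x₂, μ₂)` might have equal points or equal means. Each leg costs
    -- an extra `2 * r`, whence the `4 * r`.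
    obtain ⟨v, hvr, hv⟩ := hinf.exists_notMem_finset
      {0, x₂ - x₁, ∫ x, x ∂(μ₂ : Measure (E d)) - ∫ x, x ∂(μ₁ : Measure (E d))}
    simp only [Finset.mem_insert, Finset.mem_singleton, not_or] at hv
    obtain ⟨hv₀, hvx, hvμ⟩ := hv
    have hvn : ‖v‖ₑ ≤ r := by
      have := Metric.mem_eball.1 hvr
      rw [edist_zero_right] at this
      exact this.le
    have h₃ := h₁.translate v
    have hW := W1_translate_le μ₁ v
    set μ₃ := translate μ₁ v with hμ₃
    have hmean := integral_translate h₁ v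
    have a₁ : ‖M.f x₁ μ₁ z - M.f (x₁ + v) μ₃ z‖ₑ ≤ M.D z * (r + r) := by
      refine (M.enorm_f_sub_le_of_ne (by simpa using hv₀) ?_ h₁ h₃ z).trans ?_
      · intro h
        rw [← hμ₃, ← h] at hmean
        exact hv₀ (by simpa using hmean)
      · gcongr
        · simpa using hvn
        · exact hW.trans hvn
    have a₂ : ‖M.f (x₁ + v) μ₃ z - M.f x₂ μ₂ z‖ₑ ≤
        M.D z * ((r + ‖x₁ - x₂‖ₑ) + (r + W1 μ₁ μ₂)) := by
      refine (M.enorm_f_sub_le_of_ne ?_ ?_ h₃ h₂ z).trans ?_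
      · intro h
        exact hvx (by rw [← h]; abel)
      · intro h
        rw [← hμ₃, h] at hmean
        exact hvμ (by rw [hmean]; abel)
      · gcongr
        · calc ‖x₁ + v - x₂‖ₑ = ‖v + (x₁ - x₂)‖ₑ := by congr 1; abel
            _ ≤ ‖v‖ₑ + ‖x₁ - x₂‖ₑ := enorm_add_le _ _
            _ ≤ _ := by gcongr
        · refine (W1_triangle _ μ₁ _).trans ?_
          rw [W1_comm]
          gcongr
          exact hW.trans hvn
    calc ‖M.f x₁ μ₁ z - M.f x₂ μ₂ z‖ₑ
        = ‖(M.f x₁ μ₁ z - M.f (x₁ + v) μ₃ z) + (M.f (x₁ + v) μ₃ z - M.f x₂ μ₂ z)‖ₑ := by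
          rw [sub_add_sub_cancel]
      _ ≤ _ := (enorm_add_le _ _).trans (add_le_add a₁ a₂)
      _ = _ := by ring
  have hlim : Tendsto (fun r : ℝ≥0∞ => M.D z * (‖x₁ - x₂‖ₑ + W1 μ₁ μ₂ + 4 * r)) (𝓝[>] 0)
      (𝓝 (M.D z * (‖x₁ - x₂‖ₑ + W1 μ₁ μ₂ + 4 * 0))) := by
    refine ENNReal.Tendsto.const_mul (tendsto_const_nhds.add ?_) (Or.inr hz)
    exact ENNReal.Tendsto.const_mul (tendsto_id.mono_left nhdsWithin_le_nhds)
      (Or.inr (by norm_num))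
  rw [mul_zero, add_zero] at hlim
  exact ge_of_tendsto hlim (eventually_mem_nhdsWithin.mono fun r hr => key r hr)

theorem enorm_step_sub_le {z : E m} (hz : M.D z ≠ ∞) (x₁ x₂ : E d)
    {μ₁ μ₂ : ProbabilityMeasure (E d)} (h₁ : HasFirstMoment μ₁) (h₂ : HasFirstMoment μ₂) :
    ‖M.step x₁ μ₁ z - M.step x₂ μ₂ z‖ₑ ≤
      ‖Matrix.toEuclideanCLM (𝕜 := ℝ) M.A‖ₑ * ‖x₁ - x₂‖ₑ +
        ‖M.δ‖ₑ * (M.D z * (‖x₁ - x₂‖ₑ + W1 μ₁ μ₂)) := by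
  have e : M.step x₁ μ₁ z - M.step x₂ μ₂ z =
      Matrix.toEuclideanCLM (𝕜 := ℝ) M.A (x₁ - x₂) +
        M.δ • (M.f x₁ μ₁ z - M.f x₂ μ₂ z) := by
    simp only [step, map_sub, smul_sub]
    abel
  rw [e]
  refine (enorm_add_le _ _).trans (add_le_add ?_ ?_)
  · exact ContinuousLinearMap.le_opENorm _ _
  · rw [enorm_smul]
    gcongr
    exact M.enorm_f_sub_le hz x₁ x₂ h₁ h₂

/-- The average of a probability measure under the kernel `P^ρ`. -/
noncomputable def push (ν ρ : ProbabilityMeasure (E d)) : ProbabilityMeasure (E d) :=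
  ⟨(ν : Measure (E d)).bind (M.kernel ρ), inferInstance⟩

theorem lintegral_push (ν ρ : ProbabilityMeasure (E d)) {g : E d → ℝ≥0∞} (hg : Measurable g) :
    ∫⁻ y, g y ∂(M.push ν ρ : Measure (E d)) =
      ∫⁻ x, ∫⁻ z, g (M.step x ρ z) ∂(M.θ : Measure (E m)) ∂(ν : Measure (E d)) := by
  change ∫⁻ y, g y ∂((ν : Measure (E d)).bind (M.kernel ρ)) = _
  rw [Measure.lintegral_bind (M.kernel ρ).aemeasurable hg.aemeasurable]
  refine lintegral_congr fun x => ?_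
  change ∫⁻ y, g y ∂((M.θ : Measure (E m)).map (fun z => M.step x ρ z)) = _
  rw [lintegral_map hg (M.measurable_step_right x ρ)]

theorem measurable_step_comp {S : Type*} [MeasurableSpace S] {X : S → E d} (hX : Measurable X)
    (ρ : ProbabilityMeasure (E d)) :
    Measurable fun p : S × E m => M.step (X p.1) ρ p.2 :=
  Measurable.comp (g := fun p : E d × E m => M.step p.1 ρ p.2)
    (f := fun p : S × E m => (X p.1, p.2)) (M.measurable_step ρ)
    ((hX.comp measurable_fst).prodMk measurable_snd)

theorem measurable_lintegral_step (ρ : ProbabilityMeasure (E d)) {g : E d → ℝ≥0∞}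
    (hg : Measurable g) :
    Measurable fun x => ∫⁻ z, g (M.step x ρ z) ∂(M.θ : Measure (E m)) :=
  (hg.comp (M.measurable_step ρ)).lintegral_prod_right'

theorem map_prod_step {S : Type*} [MeasurableSpace S] {Q : Measure S} [SFinite Q] {X : S → E d}
    (hX : Measurable X) {ν : ProbabilityMeasure (E d)} (hν : Q.map X = ν)
    (ρ : ProbabilityMeasure (E d)) :
    (Q.prod (M.θ : Measure (E m))).map (fun p => M.step (X p.1) ρ p.2) = M.push ν ρ := by
  have hm := M.measurable_step_comp hX ρ
  refine Measure.ext_of_lintegral _ fun g hg => ?_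
  rw [lintegral_push M ν ρ hg, lintegral_map hg hm, ← hν,
    lintegral_map (M.measurable_lintegral_step ρ hg) hX]
  exact lintegral_prod _ (hg.comp hm).aemeasurable

/-- A Lipschitz constant for `ν ↦ ν P^ρ` with respect to `W1`, normalised to be positive. -/
noncomputable def lipConst : ℝ≥0∞ :=
  ‖Matrix.toEuclideanCLM (𝕜 := ℝ) M.A‖ₑ + ‖M.δ‖ₑ * ∫⁻ z, M.D z ∂(M.θ : Measure (E m)) + 1

theorem lipConst_ne_zero : M.lipConst ≠ 0 := by simp [lipConst]

variable {M}

theorem AssumptionA.lipConst_ne_top (hA : M.AssumptionA) : M.lipConst ≠ ∞ := by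
  refine (ENNReal.add_lt_top.2 ⟨ENNReal.add_lt_top.2 ⟨enorm_lt_top, ?_⟩, by simp⟩).ne
  exact ENNReal.mul_lt_top enorm_lt_top hA.2

theorem AssumptionA.ae_ne_top (hA : M.AssumptionA) :
    ∀ᵐ z ∂(M.θ : Measure (E m)), M.D z ≠ ∞ :=
  (ae_lt_top' hA.1 hA.2.ne).mono fun _ h => h.ne

/-- The averaged Lipschitz bound for a step with a fixed measure argument. -/
theorem AssumptionA.lintegral_step_sub_le (hA : M.AssumptionA) {ρ : ProbabilityMeasure (E d)}
    (hρ : HasFirstMoment ρ) (x₁ x₂ : E d) :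
    ∫⁻ z, ‖M.step x₁ ρ z - M.step x₂ ρ z‖ₑ ∂(M.θ : Measure (E m)) ≤
      M.lipConst * ‖x₁ - x₂‖ₑ := by
  calc _ ≤ ∫⁻ z, (‖Matrix.toEuclideanCLM (𝕜 := ℝ) M.A‖ₑ * ‖x₁ - x₂‖ₑ +
        ‖M.δ‖ₑ * ‖x₁ - x₂‖ₑ * M.D z) ∂(M.θ : Measure (E m)) := by
        refine lintegral_mono_ae (hA.ae_ne_top.mono fun z hz => ?_)
        refine (M.enorm_step_sub_le hz x₁ x₂ hρ hρ).trans_eq ?_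
        rw [W1_self, add_zero]
        ring
    _ = (‖Matrix.toEuclideanCLM (𝕜 := ℝ) M.A‖ₑ +
          ‖M.δ‖ₑ * ∫⁻ z, M.D z ∂(M.θ : Measure (E m))) * ‖x₁ - x₂‖ₑ := by
        rw [lintegral_add_left measurable_const, lintegral_const_mul'' _ hA.1, lintegral_const,
          measure_univ]
        ring
    _ ≤ _ := by
        gcongr
        exact le_self_add

/-- Synchronous coupling: both points of an arbitrary coupling of `ν₁` and `ν₂` are moved with the
same noise. -/
theorem AssumptionA.W1_push_le (hA : M.AssumptionA) {ρ : ProbabilityMeasure (E d)}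
    (hρ : HasFirstMoment ρ) (ν₁ ν₂ : ProbabilityMeasure (E d)) :
    W1 (M.push ν₁ ρ) (M.push ν₂ ρ) ≤ M.lipConst * W1 ν₁ ν₂ := by
  refine le_mul_W1 M.lipConst_ne_zero hA.lipConst_ne_top fun π h₁ h₂ => ?_
  have := isProbabilityMeasure_coupling h₁
  have m₁ := M.measurable_step_comp (measurable_fst (α := E d) (β := E d)) ρ
  have m₂ := M.measurable_step_comp (measurable_snd (α := E d) (β := E d)) ρ
  have l₁ := M.map_prod_step measurable_fst h₁ ρ
  have l₂ := M.map_prod_step measurable_snd h₂ ρ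
  refine (W1_le_lintegral m₁ m₂ l₁ l₂).trans ?_
  have hm : Measurable fun p : (E d × E d) × E m => ‖M.step p.1.1 ρ p.2 - M.step p.1.2 ρ p.2‖ₑ :=
    (m₁.sub m₂).enorm
  rw [lintegral_prod _ hm.aemeasurable, ← lintegral_const_mul _ measurable_enorm_sub]
  exact lintegral_mono fun p => hA.lintegral_step_sub_le hρ p.1 p.2

/-- The step is compared with the one from `0` under `ρ`, and that one with the step from `(0, δ₀)`,
whose size is governed by `D₁`. -/
theorem AssumptionA.hasFirstMoment_push (hA : M.AssumptionA) (hB : M.AssumptionB)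
    {ν ρ : ProbabilityMeasure (E d)} (hν : HasFirstMoment ν) (hρ : HasFirstMoment ρ) :
    HasFirstMoment (M.push ν ρ) := by
  have h₀ : HasFirstMoment (diracProba (0 : E d)) := hasFirstMoment_diracProba 0
  have hW := W1_lt_top hρ h₀
  have hb : ∫⁻ z, ‖M.step 0 ρ z‖ₑ ∂(M.θ : Measure (E m)) < ∞ := by
    calc _ ≤ ∫⁻ z, (‖M.δ‖ₑ * W1 ρ (diracProba 0) * M.D z + ‖M.δ‖ₑ * M.D₁ z)
          ∂(M.θ : Measure (E m)) := by
          refine lintegral_mono_ae (hA.ae_ne_top.mono fun z hz => ?_)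
          have h₁ := M.enorm_step_sub_le hz 0 0 hρ h₀
          have h₂ : ‖M.step 0 (diracProba 0) z‖ₑ = ‖M.δ‖ₑ * M.D₁ z := by
            simp [step, D₁, enorm_smul]
          calc ‖M.step 0 ρ z‖ₑ
              = ‖(M.step 0 ρ z - M.step 0 (diracProba 0) z) + M.step 0 (diracProba 0) z‖ₑ := by
                rw [sub_add_cancel]
            _ ≤ _ := (enorm_add_le _ _).trans (add_le_add h₁ h₂.le)
            _ = _ := by simp; ring
      _ = ‖M.δ‖ₑ * W1 ρ (diracProba 0) * ∫⁻ z, M.D z ∂(M.θ : Measure (E m)) +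
            ‖M.δ‖ₑ * ∫⁻ z, M.D₁ z ∂(M.θ : Measure (E m)) := by
          rw [lintegral_add_left' (hA.1.const_mul _), lintegral_const_mul'' _ hA.1,
            lintegral_const_mul' _ _ enorm_ne_top]
      _ < ∞ := ENNReal.add_lt_top.2
          ⟨ENNReal.mul_lt_top (ENNReal.mul_lt_top enorm_lt_top hW) hA.2,
            ENNReal.mul_lt_top enorm_lt_top hB⟩
  rw [HasFirstMoment, lintegral_push M ν ρ measurable_enorm]
  calc _ ≤ ∫⁻ x, (M.lipConst * ‖x‖ₑ + ∫⁻ z, ‖M.step 0 ρ z‖ₑ ∂(M.θ : Measure (E m)))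
        ∂(ν : Measure (E d)) := by
        refine lintegral_mono fun x => ?_
        have h := hA.lintegral_step_sub_le hρ x 0
        rw [sub_zero] at h
        refine le_trans ?_ (add_le_add h le_rfl)
        have m₀ := M.measurable_step_right 0 ρ
        have mx := M.measurable_step_right x ρ
        rw [← lintegral_add_left (by fun_prop)]
        refine lintegral_mono fun z => ?_
        calc ‖M.step x ρ z‖ₑ = ‖(M.step x ρ z - M.step 0 ρ z) + M.step 0 ρ z‖ₑ := by
              rw [sub_add_cancel]
          _ ≤ _ := enorm_add_le _ _
    _ < ∞ := by
        rw [lintegral_add_left (by fun_prop), lintegral_const_mul _ measurable_enorm,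
          lintegral_const, measure_univ, mul_one]
        exact ENNReal.add_lt_top.2 ⟨ENNReal.mul_lt_top hA.lipConst_ne_top.lt_top hν, hb⟩

theorem AssumptionA.hasFirstMoment_law (hA : M.AssumptionA) (hB : M.AssumptionB)
    {μ₀ : ProbabilityMeasure (E d)} (hμ₀ : HasFirstMoment μ₀) (n : ℕ) :
    HasFirstMoment (M.law μ₀ n) := by
  induction n with
  | zero => exact hμ₀
  | succ n ih => exact hA.hasFirstMoment_push hB ih ih

end Model

end WeaklyInteracting

/-! ### Quantization. -/

namespace WeaklyInteracting

variable {d : ℕ}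

/-- The common part of two measures need not be moved. -/
theorem W1_le_of_eq_add (μ ν : ProbabilityMeasure (E d)) (κ α β : Measure (E d))
    (hμ : (μ : Measure (E d)) = κ + α) (hν : (ν : Measure (E d)) = κ + β) :
    W1 μ ν ≤ ∫⁻ x, ‖x‖ₑ ∂α + ∫⁻ x, ‖x‖ₑ ∂β := by
  have hμ₁ : κ Set.univ + α Set.univ = 1 := by
    rw [← Measure.add_apply, ← hμ]; exact measure_univ
  have hν₁ : κ Set.univ + β Set.univ = 1 := by
    rw [← Measure.add_apply, ← hν]; exact measure_univ
  have hκ : κ Set.univ ≠ ∞ := ne_top_of_le_ne_top ENNReal.one_ne_top (hμ₁ ▸ le_self_add)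
  have hαt : α Set.univ ≠ ∞ := ne_top_of_le_ne_top ENNReal.one_ne_top (hμ₁ ▸ le_add_self)
  have hαβ : α Set.univ = β Set.univ :=
    (ENNReal.add_right_inj hκ).1 (hμ₁.trans hν₁.symm)
  have : IsFiniteMeasure α := ⟨hαt.lt_top⟩
  have : IsFiniteMeasure β := ⟨(hαβ ▸ hαt).lt_top⟩
  by_cases h₀ : α Set.univ = 0
  · have hα0 : α = 0 := Measure.measure_univ_eq_zero.1 h₀
    have hβ0 : β = 0 := Measure.measure_univ_eq_zero.1 (hαβ ▸ h₀)
    have : μ = ν := Subtype.ext (by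
      change (μ : Measure (E d)) = ν
      rw [hμ, hν, hα0, hβ0])
    rw [this, W1_self]
    exact zero_le
  have hdiag : Measurable fun x : E d => (x, x) := by fun_prop
  -- Mass in `κ` stays on the diagonal. The remainders `α` and `β` have equal mass and are coupled
  -- by their product, normalised by that mass.
  refine (W1_le_of_coupling (κ.map (fun x => (x, x)) + (α Set.univ)⁻¹ • α.prod β) ?_ ?_).trans ?_
  · rw [Measure.map_add _ _ measurable_fst, Measure.map_map measurable_fst hdiag,
      Measure.map_smul, Measure.map_fst_prod, smul_smul, ← hαβ, ENNReal.inv_mul_cancel h₀ hαt,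
      one_smul, hμ]
    congr 1
    exact Measure.map_id
  · rw [Measure.map_add _ _ measurable_snd, Measure.map_map measurable_snd hdiag,
      Measure.map_smul, Measure.map_snd_prod, smul_smul, ENNReal.inv_mul_cancel h₀ hαt,
      one_smul, hν]
    congr 1
    exact Measure.map_id
  · rw [lintegral_add_measure, lintegral_map measurable_enorm_sub hdiag, lintegral_smul_measure]
    simp only [sub_self, enorm_zero, lintegral_zero, zero_add, smul_eq_mul]
    calc (α Set.univ)⁻¹ * ∫⁻ p, ‖p.1 - p.2‖ₑ ∂(α.prod β)
        ≤ (α Set.univ)⁻¹ * ∫⁻ p, (‖p.1‖ₑ + ‖p.2‖ₑ) ∂(α.prod β) := by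
          gcongr
          exact enorm_sub_le
      _ = (α Set.univ)⁻¹ * (α Set.univ * (∫⁻ x, ‖x‖ₑ ∂α + ∫⁻ x, ‖x‖ₑ ∂β)) := by
          rw [lintegral_add_left (by fun_prop)]
          have e₁ : ∫⁻ p : E d × E d, ‖p.1‖ₑ ∂(α.prod β) = α Set.univ * ∫⁻ x, ‖x‖ₑ ∂α := by
            rw [← lintegral_map (f := fun x : E d => ‖x‖ₑ) (by fun_prop) measurable_fst,
              Measure.map_fst_prod, lintegral_smul_measure, hαβ, smul_eq_mul]
          have e₂ : ∫⁻ p : E d × E d, ‖p.2‖ₑ ∂(α.prod β) = α Set.univ * ∫⁻ x, ‖x‖ₑ ∂β := by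
            rw [← lintegral_map (f := fun x : E d => ‖x‖ₑ) (by fun_prop) measurable_snd,
              Measure.map_snd_prod, lintegral_smul_measure, smul_eq_mul]
          rw [e₁, e₂, ← mul_add]
      _ = _ := by rw [← mul_assoc, ENNReal.inv_mul_cancel h₀ hαt, one_mul]

theorem map_simpleFunc_eq_sum (μ : Measure (E d)) (q : SimpleFunc (E d) (E d)) :
    μ.map q = ∑ k ∈ q.range, μ (q ⁻¹' {k}) • Measure.dirac k := by
  refine Measure.ext_of_lintegral _ fun g hg => ?_
  rw [lintegral_map hg q.measurable, lintegral_finsetSum_measure]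
  have h := SimpleFunc.map_lintegral (μ := μ) g q
  rw [← SimpleFunc.lintegral_eq_lintegral] at h
  refine h.trans (Finset.sum_congr rfl fun k _ => ?_)
  rw [lintegral_smul_measure, lintegral_dirac' _ hg, smul_eq_mul, mul_comm]

/-- At each atom `k` the smaller of the two masses stays in place, and only the excess is
transported. -/
theorem W1_map_simpleFunc_le (μ ν : ProbabilityMeasure (E d)) (q : SimpleFunc (E d) (E d)) :
    W1 (μ.map q.measurable.aemeasurable) (ν.map q.measurable.aemeasurable) ≤
      ∑ k ∈ q.range, ‖k‖ₑ *
        (((μ : Measure (E d)) (q ⁻¹' {k}) - (ν : Measure (E d)) (q ⁻¹' {k})) +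
          ((ν : Measure (E d)) (q ⁻¹' {k}) - (μ : Measure (E d)) (q ⁻¹' {k}))) := by
  set a := fun k => (μ : Measure (E d)) (q ⁻¹' {k})
  set b := fun k => (ν : Measure (E d)) (q ⁻¹' {k})
  refine (W1_le_of_eq_add _ _ (∑ k ∈ q.range, min (a k) (b k) • Measure.dirac k)
    (∑ k ∈ q.range, (a k - b k) • Measure.dirac k)
    (∑ k ∈ q.range, (b k - a k) • Measure.dirac k) ?_ ?_).trans_eq ?_
  · change (μ : Measure (E d)).map q = _
    rw [map_simpleFunc_eq_sum, ← Finset.sum_add_distrib]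
    refine Finset.sum_congr rfl fun k _ => ?_
    rw [← add_smul]
    congr 1
    rw [add_comm]
    exact (tsub_add_min (a := a k) (b := b k)).symm
  · change (ν : Measure (E d)).map q = _
    rw [map_simpleFunc_eq_sum, ← Finset.sum_add_distrib]
    refine Finset.sum_congr rfl fun k _ => ?_
    rw [← add_smul]
    congr 1
    rw [add_comm, min_comm]
    exact (tsub_add_min (a := b k) (b := a k)).symm
  · rw [lintegral_finsetSum_measure, lintegral_finsetSum_measure, ← Finset.sum_add_distrib]
    refine Finset.sum_congr rfl fun k _ => ?_
    rw [lintegral_smul_measure, lintegral_smul_measure, lintegral_dirac' _ measurable_enorm,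
      smul_eq_mul, smul_eq_mul]
    ring

theorem W1_map_le (μ : ProbabilityMeasure (E d)) (q : SimpleFunc (E d) (E d)) :
    W1 μ (μ.map q.measurable.aemeasurable) ≤ ∫⁻ x, ‖x - q x‖ₑ ∂(μ : Measure (E d)) :=
  W1_le_lintegral measurable_id q.measurable Measure.map_id rfl

/-- `W1` is controlled by a quantization error and the masses of finitely many cells. -/
theorem W1_le_quantization (μ ν : ProbabilityMeasure (E d)) (q : SimpleFunc (E d) (E d)) :
    W1 μ ν ≤ ∫⁻ x, ‖x - q x‖ₑ ∂(μ : Measure (E d)) + ∫⁻ x, ‖x - q x‖ₑ ∂(ν : Measure (E d)) +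
      ∑ k ∈ q.range, ‖k‖ₑ *
        (((μ : Measure (E d)) (q ⁻¹' {k}) - (ν : Measure (E d)) (q ⁻¹' {k})) +
          ((ν : Measure (E d)) (q ⁻¹' {k}) - (μ : Measure (E d)) (q ⁻¹' {k}))) := by
  refine (W1_triangle μ (μ.map q.measurable.aemeasurable) ν).trans ?_
  refine (add_le_add le_rfl (W1_triangle _ (ν.map q.measurable.aemeasurable) ν)).trans ?_
  rw [add_assoc, add_comm (∫⁻ x, ‖x - q x‖ₑ ∂(ν : Measure (E d)))]
  refine add_le_add (W1_map_le μ q) (add_le_add (W1_map_simpleFunc_le μ ν q) ?_)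
  rw [W1_comm]
  exact W1_map_le ν q

/-- Sending `x` to the nearest of the first points of a dense sequence makes `‖x - q x‖` the
distance to a finite set, hence 1-Lipschitz. Its integral tends to zero by dominated convergence. -/
theorem exists_quantizer {μ : ProbabilityMeasure (E d)} (hμ : HasFirstMoment μ) {η : ℝ≥0∞}
    (hη : 0 < η) :
    ∃ q : SimpleFunc (E d) (E d), (∀ x y, ‖x - q x‖ₑ ≤ ‖y - q y‖ₑ + ‖x - y‖ₑ) ∧
      ∫⁻ x, ‖x - q x‖ₑ ∂(μ : Measure (E d)) ≤ η := by
  set e := TopologicalSpace.denseSeq (E d)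
  have hlip : ∀ n x y, ‖x - SimpleFunc.nearestPt e n x‖ₑ ≤
      ‖y - SimpleFunc.nearestPt e n y‖ₑ + ‖x - y‖ₑ := by
    intro n x y
    have h : edist (SimpleFunc.nearestPt e n x) x ≤ edist (SimpleFunc.nearestPt e n y) x :=
      SimpleFunc.edist_nearestPt_le e x (SimpleFunc.nearestPtInd_le e n y)
    rw [← edist_eq_enorm_sub, ← edist_eq_enorm_sub, ← edist_eq_enorm_sub, edist_comm x]
    refine h.trans ((edist_triangle _ y _).trans_eq ?_)
    rw [edist_comm y x, edist_comm y]
  have hlim : Tendsto (fun n => ∫⁻ x, ‖x - SimpleFunc.nearestPt e n x‖ₑ ∂(μ : Measure (E d)))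
      atTop (𝓝 (∫⁻ _, 0 ∂(μ : Measure (E d)))) := by
    -- The point `e 0` is always among the candidates, so the error never exceeds the distance to `e
    -- 0`.
    refine tendsto_lintegral_of_dominated_convergence (fun x => ‖x‖ₑ + ‖e 0‖ₑ) (fun n => ?_)
      (fun n => ae_of_all _ fun x => ?_) ?_ (ae_of_all _ fun x => ?_)
    · exact (measurable_id.sub (SimpleFunc.measurable _)).enorm
    · beta_reduce
      rw [← edist_eq_enorm_sub, edist_comm]
      refine (SimpleFunc.edist_nearestPt_le e x (Nat.zero_le n)).trans ?_
      rw [edist_comm, edist_eq_enorm_sub]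
      exact enorm_sub_le
    · rw [lintegral_add_left (by fun_prop), lintegral_const, measure_univ, mul_one]
      exact (ENNReal.add_lt_top.2 ⟨hμ, enorm_lt_top⟩).ne
    · have h := SimpleFunc.tendsto_nearestPt (e := e) (x := x)
        ((TopologicalSpace.denseRange_denseSeq (E d)) x)
      have h' := (tendsto_const_nhds (x := x)).sub h
      rw [sub_self] at h'
      simpa using h'.enorm
  rw [lintegral_zero] at hlim
  obtain ⟨n, hn⟩ := ((tendsto_order.1 hlim).2 η hη).exists
  exact ⟨_, hlip n, hn.le⟩

/-! ### A weak law of large numbers. -/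

theorem tsub_add_tsub_eq_enorm {a b : ℝ≥0∞} (ha : a ≠ ∞) (hb : b ≠ ∞) :
    (a - b) + (b - a) = ‖a.toReal - b.toReal‖ₑ := by
  lift a to NNReal using ha
  lift b to NNReal using hb
  rcases le_total a b with h | h
  · have h' : (a : ℝ) - b ≤ 0 := sub_nonpos.2 (by exact_mod_cast h)
    rw [tsub_eq_zero_of_le (by exact_mod_cast h : (a : ℝ≥0∞) ≤ b), zero_add,
      ENNReal.coe_toReal, ENNReal.coe_toReal, enorm_sub_rev,
      Real.enorm_eq_ofReal (by linarith), ENNReal.ofReal_sub _ a.coe_nonneg]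
    simp
  · have h' : 0 ≤ (a : ℝ) - b := sub_nonneg.2 (by exact_mod_cast h)
    rw [tsub_eq_zero_of_le (by exact_mod_cast h : (b : ℝ≥0∞) ≤ a), add_zero,
      ENNReal.coe_toReal, ENNReal.coe_toReal, Real.enorm_eq_ofReal h', ENNReal.ofReal_sub _ b.coe_nonneg]
    simp

/-- On a probability space the `L¹` norm of the centred variable is at most its `L²` norm, the
standard deviation. -/
theorem lintegral_enorm_sub_mean_le {S : Type*} [MeasurableSpace S] {Q : Measure S}
    [IsProbabilityMeasure Q] {Y : S → ℝ} (hY : MemLp Y 2 Q) :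
    ∫⁻ s, ‖Y s - Q[Y]‖ₑ ∂Q ≤ (ENNReal.ofReal Var[Y; Q]) ^ (1 / 2 : ℝ) := by
  have h := eLpNorm_le_eLpNorm_of_exponent_le (p := 1) (q := 2) (μ := Q)
    (f := fun s => Y s - Q[Y]) (by norm_num)
    (hY.aestronglyMeasurable.sub aestronglyMeasurable_const)
  rw [eLpNorm_one_eq_lintegral_enorm,
    eLpNorm_eq_lintegral_rpow_enorm_toReal (by norm_num) (by norm_num)] at h
  refine h.trans_eq ?_
  rw [hY.ofReal_variance_eq, evariance]
  simp

/-- A weak law of large numbers for independent, not identically distributed variables with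
values in the unit interval. -/
theorem lintegral_pi_average_sub_mean_le {S : Type*} [MeasurableSpace S] {Q : Measure S}
    [IsProbabilityMeasure Q] {N : ℕ+} {h : Fin N → S → ℝ} (hm : ∀ i, Measurable (h i))
    (hb : ∀ i s, h i s ∈ Set.Icc (0 : ℝ) 1) :
    ∫⁻ z, ‖(N : ℝ)⁻¹ * ∑ i, h i (z i) -
        ∫ z, (N : ℝ)⁻¹ * ∑ i, h i (z i) ∂(Measure.pi fun _ : Fin N => Q)‖ₑ
        ∂(Measure.pi fun _ : Fin N => Q) ≤ (((N : ℕ) : ℝ≥0∞)⁻¹) ^ (1 / 2 : ℝ) := by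
  have hL : ∀ i, MemLp (h i) 2 Q := fun i =>
    MemLp.of_bound (hm i).aestronglyMeasurable 1 (ae_of_all _ fun s => by
      rw [Real.norm_eq_abs, abs_of_nonneg (hb i s).1]
      exact (hb i s).2)
  have hLs : MemLp (fun z : Fin N → S => (N : ℝ)⁻¹ * ∑ i, h i (z i)) 2
      (Measure.pi fun _ : Fin N => Q) :=
    (memLp_finsetSum _ fun i _ =>
      (hL i).comp_measurePreserving (measurePreserving_eval (fun _ : Fin N => Q) i)).const_mul _
  refine (lintegral_enorm_sub_mean_le hLs).trans ?_
  gcongr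
  have hvar : Var[fun z : Fin N → S => (N : ℝ)⁻¹ * ∑ i, h i (z i);
      Measure.pi fun _ : Fin N => Q] ≤ (N : ℝ)⁻¹ := by
    rw [variance_const_mul]
    have hs := variance_sum_pi (μ := fun _ : Fin N => Q) hL
    have e : (∑ i, fun ω : Fin N → S => h i (ω i)) = fun ω => ∑ i, h i (ω i) := by
      ext ω; simp
    rw [e] at hs
    rw [hs]
    have hle : ∑ i, Var[h i; Q] ≤ ∑ _i : Fin N, (1 : ℝ) := by
      refine Finset.sum_le_sum fun i _ => ?_
      -- A variable with values in an interval of length one has variance at most `1/4`; the cruder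
      -- bound `1` suffices.
      refine (variance_le_sq_of_bounded (ae_of_all _ (hb i)) (hm i).aemeasurable).trans ?_
      norm_num
    rw [Finset.sum_const, Finset.card_univ, Fintype.card_fin, nsmul_eq_mul, mul_one] at hle
    have hN : (0 : ℝ) < (N : ℝ) := by exact_mod_cast N.pos
    calc ((N : ℝ)⁻¹) ^ 2 * ∑ i, Var[h i; Q] ≤ ((N : ℝ)⁻¹) ^ 2 * (N : ℝ) := by gcongr
      _ = _ := by field_simp
  refine (ENNReal.ofReal_le_ofReal hvar).trans_eq ?_
  rw [ENNReal.ofReal_inv_of_pos (by exact_mod_cast N.pos), ENNReal.ofReal_natCast]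

end WeaklyInteracting

/-! ### The one-step estimate from a deterministic configuration. -/

namespace WeaklyInteracting

namespace Model

variable {d m : ℕ} (M : Model d m) {N : ℕ+}

theorem measurable_step_particle : Measurable fun p : (Fin N → E d) × (Fin N → E m) =>
    fun i => M.step (p.1 i) (empirical p.1) (p.2 i) := by
  refine measurable_pi_lambda _ fun i => ?_
  have h₁ : Measurable fun p : (Fin N → E d) × (Fin N → E m) => p.1 i := by fun_prop
  have h₂ : Measurable fun p : (Fin N → E d) × (Fin N → E m) => empirical p.1 :=
    measurable_empirical.comp measurable_fst
  have h₃ : Measurable fun p : (Fin N → E d) × (Fin N → E m) => p.2 i := by fun_prop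
  have h : Measurable fun p : (Fin N → E d) × (Fin N → E m) =>
      M.f (p.1 i) (empirical p.1) (p.2 i) :=
    M.measurable_f.comp (h₁.prodMk (h₂.prodMk h₃))
  unfold step
  fun_prop

theorem measurable_step_noise (x : Fin N → E d) (ρ : ProbabilityMeasure (E d)) (i : Fin N) :
    Measurable fun z : Fin N → E m => M.step (x i) ρ (z i) :=
  (M.measurable_step_right (x i) ρ).comp (measurable_pi_apply i)

theorem lintegral_noise_eval (i : Fin N) {h : E m → ℝ≥0∞} (hh : Measurable h) :
    ∫⁻ z, h (z i) ∂(Measure.pi fun _ : Fin N => (M.θ : Measure (E m))) =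
      ∫⁻ z, h z ∂(M.θ : Measure (E m)) :=
  (measurePreserving_eval (fun _ : Fin N => (M.θ : Measure (E m))) i).lintegral_comp hh

/-- Averaging the empirical measure after a step with frozen measure argument over the noise. -/
theorem lintegral_lintegral_empirical_step (x : Fin N → E d) (ρ : ProbabilityMeasure (E d))
    {g : E d → ℝ≥0∞} (hg : Measurable g) :
    ∫⁻ z, ∫⁻ y, g y ∂(empirical fun i => M.step (x i) ρ (z i) : Measure (E d))
        ∂(Measure.pi fun _ : Fin N => (M.θ : Measure (E m))) =
      ∫⁻ y, g y ∂(M.push (empirical x) ρ : Measure (E d)) := by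
  simp_rw [lintegral_empirical _ hg]
  have hm : ∀ i : Fin N, Measurable fun z : Fin N → E m => g (M.step (x i) ρ (z i)) :=
    fun i => hg.comp (M.measurable_step_noise x ρ i)
  rw [lintegral_const_mul _ (Finset.measurable_sum _ fun i _ => hm i),
    lintegral_finsetSum _ fun i _ => hm i, lintegral_push M _ _ hg,
    lintegral_empirical _ (M.measurable_lintegral_step ρ hg)]
  congr 1
  refine Finset.sum_congr rfl fun i _ => ?_
  exact M.lintegral_noise_eval i (hg.comp (M.measurable_step_right (x i) ρ))

theorem measurable_empirical_step_apply (x : Fin N → E d) (ρ : ProbabilityMeasure (E d))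
    {C : Set (E d)} (hC : MeasurableSet C) :
    Measurable fun z : Fin N → E m =>
      (empirical fun i => M.step (x i) ρ (z i) : Measure (E d)) C := by
  simp_rw [empirical_apply _ hC]
  refine Measurable.const_mul (Finset.measurable_sum _ fun i _ => ?_) _
  exact (measurable_const.indicator hC).comp (M.measurable_step_noise x ρ i)

/-- The mass of `C` is an average of indicators of independent events, one per particle, and its
mean is the mass under the pushed measure. The bound is uniform in `x`, `ρ` and `C`. -/
theorem lintegral_mass_deviation_le (x : Fin N → E d) (ρ : ProbabilityMeasure (E d))
    {C : Set (E d)} (hC : MeasurableSet C) :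
    ∫⁻ z, (((empirical fun i => M.step (x i) ρ (z i) : Measure (E d)) C -
          (M.push (empirical x) ρ : Measure (E d)) C) +
        ((M.push (empirical x) ρ : Measure (E d)) C -
          (empirical fun i => M.step (x i) ρ (z i) : Measure (E d)) C))
        ∂(Measure.pi fun _ : Fin N => (M.θ : Measure (E m))) ≤
      (((N : ℕ) : ℝ≥0∞)⁻¹) ^ (1 / 2 : ℝ) := by
  set h : Fin N → E m → ℝ := fun i z => C.indicator (fun _ => (1 : ℝ)) (M.step (x i) ρ z) with hh
  have hm : ∀ i, Measurable (h i) := fun i =>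
    (measurable_const.indicator hC).comp (M.measurable_step_right (x i) ρ)
  have hb : ∀ i s, h i s ∈ Set.Icc (0 : ℝ) 1 := by
    intro i s
    simp only [hh, Set.indicator]
    split_ifs <;> simp
  have he : ∀ z : Fin N → E m,
      ((empirical fun i => M.step (x i) ρ (z i) : Measure (E d)) C).toReal =
        (N : ℝ)⁻¹ * ∑ i, h i (z i) := by
    intro z
    rw [empirical_apply _ hC, ENNReal.toReal_mul, ENNReal.toReal_sum]
    · congr 1
      · simp
      · refine Finset.sum_congr rfl fun i _ => ?_
        simp only [hh, Set.indicator]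
        split_ifs <;> simp
    · intro i _
      simp only [Set.indicator]
      split_ifs <;> simp
  have hmean : ((M.push (empirical x) ρ : Measure (E d)) C).toReal =
      ∫ z, (N : ℝ)⁻¹ * ∑ i, h i (z i) ∂(Measure.pi fun _ : Fin N => (M.θ : Measure (E m))) := by
    simp_rw [← he]
    rw [integral_toReal (M.measurable_empirical_step_apply x ρ hC).aemeasurable
      (ae_of_all _ fun z => measure_lt_top _ _)]
    congr 1
    have := M.lintegral_lintegral_empirical_step x ρ
      (measurable_one.indicator hC : Measurable (C.indicator (1 : E d → ℝ≥0∞)))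
    simp_rw [lintegral_indicator_one hC] at this
    exact this.symm
  refine le_trans (le_of_eq ?_)
    (lintegral_pi_average_sub_mean_le (Q := (M.θ : Measure (E m))) hm hb)
  refine lintegral_congr fun z => ?_
  rw [tsub_add_tsub_eq_enorm (measure_ne_top _ _) (measure_ne_top _ _), he, hmean]

variable {M}

theorem AssumptionA.lintegral_step_sub_step_le (hA : M.AssumptionA)
    {ν ρ : ProbabilityMeasure (E d)} (hν : HasFirstMoment ν) (hρ : HasFirstMoment ρ) (x : E d) :
    ∫⁻ z, ‖M.step x ρ z - M.step x ν z‖ₑ ∂(M.θ : Measure (E m)) ≤ M.lipConst * W1 ρ ν := by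
  calc _ ≤ ∫⁻ z, ‖M.δ‖ₑ * W1 ρ ν * M.D z ∂(M.θ : Measure (E m)) := by
        refine lintegral_mono_ae (hA.ae_ne_top.mono fun z hz => ?_)
        refine (M.enorm_step_sub_le hz x x hρ hν).trans_eq ?_
        simp only [sub_self, enorm_zero, mul_zero, zero_add]
        ring
    _ = (‖M.δ‖ₑ * ∫⁻ z, M.D z ∂(M.θ : Measure (E m))) * W1 ρ ν := by
        rw [lintegral_const_mul'' _ hA.1]
        ring
    _ ≤ _ := by
        gcongr
        exact le_add_self.trans le_self_add

/-- The expected distance to the limit law after one step from a deterministic configuration. -/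
theorem AssumptionA.lintegral_W1_step_le (hA : M.AssumptionA) {ν : ProbabilityMeasure (E d)}
    (hν : HasFirstMoment ν) {q : SimpleFunc (E d) (E d)}
    (hlip : ∀ x y, ‖x - q x‖ₑ ≤ ‖y - q y‖ₑ + ‖x - y‖ₑ) {η : ℝ≥0∞}
    (hq : ∫⁻ x, ‖x - q x‖ₑ ∂(M.Psi ν : Measure (E d)) ≤ η) (x : Fin N → E d) :
    ∫⁻ z, W1 (empirical fun i => M.step (x i) (empirical x) (z i)) (M.Psi ν)
        ∂(Measure.pi fun _ : Fin N => (M.θ : Measure (E m))) ≤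
      4 * M.lipConst * W1 (empirical x) ν +
        (2 * η + (∑ k ∈ q.range, ‖k‖ₑ) * (((N : ℕ) : ℝ≥0∞)⁻¹) ^ (1 / 2 : ℝ)) := by
  set Q := Measure.pi fun _ : Fin N => (M.θ : Measure (E m)) with hQ
  set W := W1 (empirical x) ν with hW
  set L := M.lipConst
  set g : E d → ℝ≥0∞ := fun y => ‖y - q y‖ₑ with hg_def
  have hg : Measurable g := (measurable_id.sub q.measurable).enorm
  set ρ' := M.push (empirical x) ν with hρ'
  -- With the measure argument frozen at `ν`, the mean of `ρ z` is `ρ'`, and `ρ'` and `M.Psi ν` are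
  -- images of the empirical measure and of `ν` under the same kernel.
  set ρ : (Fin N → E m) → ProbabilityMeasure (E d) :=
    fun z => empirical fun i => M.step (x i) ν (z i) with hρ
  have hx := hasFirstMoment_empirical x
  have hpush : W1 ρ' (M.Psi ν) ≤ L * W := hA.W1_push_le hν (empirical x) ν
  have hg' : ∫⁻ y, g y ∂(ρ' : Measure (E d)) ≤ η + L * W :=
    (lintegral_le_lintegral_add_W1 ρ' (M.Psi ν) hg hlip).trans (add_le_add hq hpush)
  set a : (Fin N → E m) → ℝ≥0∞ := fun z => ((N : ℕ) : ℝ≥0∞)⁻¹ *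
    ∑ i, ‖M.step (x i) (empirical x) (z i) - M.step (x i) ν (z i)‖ₑ with ha_def
  set b : (Fin N → E m) → ℝ≥0∞ := fun z => ∫⁻ y, g y ∂(ρ z : Measure (E d)) with hb_def
  set c : (Fin N → E m) → E d → ℝ≥0∞ := fun z k =>
    ((ρ z : Measure (E d)) (q ⁻¹' {k}) - (ρ' : Measure (E d)) (q ⁻¹' {k})) +
      ((ρ' : Measure (E d)) (q ⁻¹' {k}) - (ρ z : Measure (E d)) (q ⁻¹' {k})) with hc_def
  -- After integration `L * W` occurs four times: from `a`, from the quantization errors of `ρ z`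
  -- and of `ρ'`, and from `ρ'` against `M.Psi ν`. The two quantization errors also give the `2 *
  -- η`.
  have hpt : ∀ z, W1 (empirical fun i => M.step (x i) (empirical x) (z i)) (M.Psi ν) ≤
      a z + (b z + (∑ k ∈ q.range, ‖k‖ₑ * c z k + (η + L * W + L * W))) := by
    intro z
    calc _ ≤ _ := W1_triangle _ (ρ z) _
      _ ≤ _ := add_le_add le_rfl (W1_triangle _ ρ' _)
      _ ≤ a z + ((b z + (η + L * W) + ∑ k ∈ q.range, ‖k‖ₑ * c z k) + L * W) := by
        refine add_le_add (W1_empirical_le _ _) (add_le_add ?_ hpush)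
        refine (W1_le_quantization (ρ z) ρ' q).trans ?_
        gcongr
      _ = _ := by ring
  have hstep : ∀ i, Measurable fun z : E m => ‖M.step (x i) (empirical x) z - M.step (x i) ν z‖ₑ :=
    fun i => ((M.measurable_step_right _ _).sub (M.measurable_step_right _ _)).enorm
  have hstep' : ∀ i, Measurable fun z : Fin N → E m =>
      ‖M.step (x i) (empirical x) (z i) - M.step (x i) ν (z i)‖ₑ :=
    fun i => (hstep i).comp (measurable_pi_apply i)
  have ha : Measurable a := (Finset.measurable_sum _ fun i _ => hstep' i).const_mul _
  have hb : Measurable b := by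
    simp_rw [hb_def, hρ, lintegral_empirical _ hg]
    exact (Finset.measurable_sum _ fun i _ =>
      hg.comp (M.measurable_step_noise x ν i)).const_mul _
  have hc : ∀ k, Measurable fun z => c z k := fun k => by
    have := M.measurable_empirical_step_apply x ν (q.measurableSet_fiber k)
    exact (this.sub measurable_const).add (measurable_const.sub this)
  have ia : ∫⁻ z, a z ∂Q ≤ L * W := by
    rw [ha_def, lintegral_const_mul _ (Finset.measurable_sum _ fun i _ => hstep' i),
      lintegral_finsetSum _ fun i _ => hstep' i]
    calc _ ≤ ((N : ℕ) : ℝ≥0∞)⁻¹ * ∑ _i : Fin N, L * W := by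
          refine mul_le_mul_right (Finset.sum_le_sum fun i _ => ?_) _
          rw [hQ, M.lintegral_noise_eval i (hstep i)]
          exact hA.lintegral_step_sub_step_le hν hx (x i)
      _ = L * W := by
          rw [Finset.sum_const, Finset.card_univ, Fintype.card_fin, nsmul_eq_mul, ← mul_assoc,
            ENNReal.inv_mul_cancel (by simp) (by simp), one_mul]
  have ib : ∫⁻ z, b z ∂Q ≤ η + L * W :=
    (M.lintegral_lintegral_empirical_step x ν hg).trans_le hg'
  have ic : ∫⁻ z, ∑ k ∈ q.range, ‖k‖ₑ * c z k ∂Q ≤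
      (∑ k ∈ q.range, ‖k‖ₑ) * (((N : ℕ) : ℝ≥0∞)⁻¹) ^ (1 / 2 : ℝ) := by
    rw [lintegral_finsetSum _ fun k _ => (hc k).const_mul _, Finset.sum_mul]
    refine Finset.sum_le_sum fun k _ => ?_
    rw [lintegral_const_mul _ (hc k)]
    exact mul_le_mul_right (M.lintegral_mass_deviation_le x ν (q.measurableSet_fiber k)) _
  have hcs : Measurable fun z => ∑ k ∈ q.range, ‖k‖ₑ * c z k :=
    Finset.measurable_sum _ fun k _ => (hc k).const_mul _
  calc _ ≤ _ := lintegral_mono hpt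
    _ = ∫⁻ z, a z ∂Q + (∫⁻ z, b z ∂Q + (∫⁻ z, ∑ k ∈ q.range, ‖k‖ₑ * c z k ∂Q +
          (η + L * W + L * W))) := by
        rw [lintegral_add_left ha, lintegral_add_left hb, lintegral_add_left hcs,
          lintegral_const, measure_univ, mul_one]
    _ ≤ L * W + (η + L * W + ((∑ k ∈ q.range, ‖k‖ₑ) * (((N : ℕ) : ℝ≥0∞)⁻¹) ^ (1 / 2 : ℝ) +
          (η + L * W + L * W))) := by gcongr
    _ = _ := by ring

end Model

end WeaklyInteracting

/-! ### Independence of state and noise, and the recursion. -/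

namespace WeaklyInteracting

/-- The joint law of the triple is a product of its three marginals, which may be regrouped by
associativity. -/
theorem indepFun_prodMk_left_of_indepFun {Ω α β γ : Type*} [MeasurableSpace Ω]
    [MeasurableSpace α] [MeasurableSpace β] [MeasurableSpace γ] {P : Measure Ω}
    [IsProbabilityMeasure P] {X : Ω → α} {Y : Ω → β} {Z : Ω → γ} (hX : Measurable X)
    (hY : Measurable Y) (hZ : Measurable Z) (hYZ : IndepFun Y Z P)
    (hXYZ : IndepFun X (fun ω => (Y ω, Z ω)) P) :
    IndepFun (fun ω => (X ω, Y ω)) Z P := by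
  have h₁ := (indepFun_iff_map_prod_eq_prod_map_map hX.aemeasurable
    (hY.prodMk hZ).aemeasurable).1 hXYZ
  have h₂ := (indepFun_iff_map_prod_eq_prod_map_map hY.aemeasurable hZ.aemeasurable).1 hYZ
  have h₃ := (indepFun_iff_map_prod_eq_prod_map_map hX.aemeasurable hY.aemeasurable).1
    (hXYZ.comp measurable_id measurable_fst : IndepFun (id ∘ X) (Prod.fst ∘ _) P)
  have := Measure.isProbabilityMeasure_map (μ := P) hX.aemeasurable
  have := Measure.isProbabilityMeasure_map (μ := P) hY.aemeasurable
  have := Measure.isProbabilityMeasure_map (μ := P) hZ.aemeasurable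
  refine (indepFun_iff_map_prod_eq_prod_map_map (hX.prodMk hY).aemeasurable
    hZ.aemeasurable).2 ?_
  rw [h₃]
  apply MeasurableEquiv.prodAssoc.map_measurableEquiv_injective
  rw [Measure.prodAssoc_prod, ← h₂, ← h₁, Measure.map_map
    MeasurableEquiv.prodAssoc.measurable ((hX.prodMk hY).prodMk hZ)]
  rfl

namespace Model

variable {d m : ℕ} (M : Model d m) {N : ℕ+}

theorem measurable_particles (n : ℕ) :
    Measurable fun p : (Fin N → E d) × (ℕ → Fin N → E m) => M.particles p.1 p.2 n := by
  induction n with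
  | zero => exact measurable_fst
  | succ n ih =>
    have h : Measurable fun p : (Fin N → E d) × (ℕ → Fin N → E m) => p.2 n :=
      (measurable_pi_apply n).comp measurable_snd
    have e : (fun p : (Fin N → E d) × (ℕ → Fin N → E m) => M.particles p.1 p.2 (n + 1)) =
        (fun p : (Fin N → E d) × (Fin N → E m) =>
          fun i => M.step (p.1 i) (empirical p.1) (p.2 i)) ∘
          fun p : (Fin N → E d) × (ℕ → Fin N → E m) => (M.particles p.1 p.2 n, p.2 n) := rfl
    rw [e]
    exact M.measurable_step_particle.comp (ih.prodMk h)

theorem particles_congr (x : Fin N → E d) {e e' : ℕ → Fin N → E m} {n : ℕ}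
    (h : ∀ k < n, e k = e' k) : M.particles x e n = M.particles x e' n := by
  induction n with
  | zero => rfl
  | succ n ih =>
    simp only [particles, ih fun k hk => h k (hk.trans n.lt_succ_self), h n n.lt_succ_self]

variable {Ω : Type*} [MeasurableSpace Ω] {P : Measure Ω} [IsProbabilityMeasure P]
  {X₀ : Fin N → Ω → E d} {ε : ℕ → Fin N → Ω → E m}

/-- The state at time `n` is a function of the initial positions and the noise with indices below
`n`, while `ε n` drives the following step; the two index sets are disjoint. -/
theorem indepFun_particles_noise (hX₀ : ∀ i, Measurable (X₀ i))
    (hε : ∀ n i, Measurable (ε n i))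
    (hindep : iIndepFun (fun p : ℕ × Fin N => ε p.1 p.2) P)
    (hX₀ε : IndepFun (fun ω i => X₀ i ω) (fun ω (p : ℕ × Fin N) => ε p.1 p.2 ω) P) (n : ℕ) :
    IndepFun (fun ω => M.particles (fun i => X₀ i ω) (fun k i => ε k i ω) n)
      (fun ω i => ε n i ω) P := by
  set S : Finset (ℕ × Fin N) := Finset.range n ×ˢ Finset.univ with hS
  set T : Finset (ℕ × Fin N) := {n} ×ˢ Finset.univ with hT
  have hST : Disjoint S T := by
    rw [Finset.disjoint_left]
    rintro ⟨k, i⟩ hk hk'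
    simp only [hS, hT, Finset.mem_product, Finset.mem_range, Finset.mem_singleton] at hk hk'
    omega
  have hpn := hindep.indepFun_finset S T hST fun p => hε p.1 p.2
  have hrestr : Measurable fun w : ℕ × Fin N → E m =>
      ((fun p : S => w p), (fun p : T => w p)) := by fun_prop
  have hXpn := hX₀ε.comp measurable_id hrestr
  have hXm : Measurable fun ω i => X₀ i ω := measurable_pi_lambda _ hX₀
  have hSm : Measurable fun ω (p : S) => ε p.1.1 p.1.2 ω :=
    measurable_pi_lambda _ fun p => hε _ _
  have hTm : Measurable fun ω (p : T) => ε p.1.1 p.1.2 ω :=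
    measurable_pi_lambda _ fun p => hε _ _
  have hind := indepFun_prodMk_left_of_indepFun hXm hSm hTm hpn hXpn
  -- The finite noise record is extended by zero to a full sequence; by `particles_congr` the added
  -- values do not affect the state at time `n`.
  set pad : (S → E m) → ℕ → Fin N → E m :=
    fun w k i => if h : (k, i) ∈ S then w ⟨(k, i), h⟩ else 0 with hpad_def
  have hpad : Measurable pad := by
    refine measurable_pi_lambda _ fun k => measurable_pi_lambda _ fun i => ?_
    by_cases h : (k, i) ∈ S
    · have e : (fun w => pad w k i) = fun w => w ⟨(k, i), h⟩ := by
        funext w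
        exact dif_pos h
      rw [e]
      exact measurable_pi_apply _
    · have e : (fun w => pad w k i) = fun _ => 0 := by
        funext w
        exact dif_neg h
      rw [e]
      exact measurable_const
  have hext : Measurable fun p : (Fin N → E d) × (S → E m) => M.particles p.1 (pad p.2) n :=
    Measurable.comp (f := fun p : (Fin N → E d) × (S → E m) => (p.1, pad p.2))
      (g := fun p : (Fin N → E d) × (ℕ → Fin N → E m) => M.particles p.1 p.2 n)
      (M.measurable_particles n) (measurable_fst.prodMk (hpad.comp measurable_snd))
  have hsel : Measurable fun (w : T → E m) (i : Fin N) => w ⟨(n, i), by simp [hT]⟩ := by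
    fun_prop
  have hres := hind.comp hext hsel
  have e : (fun ω => M.particles (fun i => X₀ i ω) (fun k i => ε k i ω) n) =
      (fun p : (Fin N → E d) × (S → E m) => M.particles p.1 (pad p.2) n) ∘
        fun ω => (fun i => X₀ i ω, fun p : S => ε p.1.1 p.1.2 ω) := by
    funext ω
    refine M.particles_congr _ fun k hk => ?_
    funext i
    have : (k, i) ∈ S := by simp [hS, hk]
    simp [hpad_def, this]
  rw [e]
  exact hres

theorem map_noise_eq_pi (hε : ∀ n i, Measurable (ε n i))
    (hlaw : ∀ n i, P.map (ε n i) = M.θ)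
    (hindep : iIndepFun (fun p : ℕ × Fin N => ε p.1 p.2) P) (n : ℕ) :
    P.map (fun ω i => ε n i ω) = Measure.pi fun _ : Fin N => (M.θ : Measure (E m)) := by
  have h := hindep.precomp (g := fun i : Fin N => (n, i)) (fun i j hij => by simpa using hij)
  rw [iIndepFun_iff_map_fun_eq_pi_map fun i => (hε n i).aemeasurable] at h
  rw [h]
  simp_rw [hlaw]

/-- The expected distance to the limit law grows by at most a factor and a small error
in each step. -/
theorem AssumptionA.lintegral_W1_particles_succ_le {M : Model d m} (hA : M.AssumptionA)
    (hB : M.AssumptionB) {μ₀ : ProbabilityMeasure (E d)} (hμ₀ : HasFirstMoment μ₀)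
    (hX₀ : ∀ i, Measurable (X₀ i)) (hε : ∀ n i, Measurable (ε n i))
    (hlaw : ∀ n i, P.map (ε n i) = M.θ)
    (hindep : iIndepFun (fun p : ℕ × Fin N => ε p.1 p.2) P)
    (hX₀ε : IndepFun (fun ω i => X₀ i ω) (fun ω (p : ℕ × Fin N) => ε p.1 p.2 ω) P) (n : ℕ)
    {q : SimpleFunc (E d) (E d)} (hlip : ∀ x y, ‖x - q x‖ₑ ≤ ‖y - q y‖ₑ + ‖x - y‖ₑ)
    {η : ℝ≥0∞} (hq : ∫⁻ x, ‖x - q x‖ₑ ∂(M.law μ₀ (n + 1) : Measure (E d)) ≤ η) :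
    ∫⁻ ω, W1 (empirical (M.particles (fun i => X₀ i ω) (fun k i => ε k i ω) (n + 1)))
        (M.law μ₀ (n + 1)) ∂P ≤
      4 * M.lipConst * ∫⁻ ω, W1 (empirical
          (M.particles (fun i => X₀ i ω) (fun k i => ε k i ω) n)) (M.law μ₀ n) ∂P +
        (2 * η + (∑ k ∈ q.range, ‖k‖ₑ) * (((N : ℕ) : ℝ≥0∞)⁻¹) ^ (1 / 2 : ℝ)) := by
  set U : Ω → Fin N → E d := fun ω => M.particles (fun i => X₀ i ω) (fun k i => ε k i ω) n
  set V : Ω → Fin N → E m := fun ω i => ε n i ω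
  set Q := Measure.pi fun _ : Fin N => (M.θ : Measure (E m))
  have hν := hA.hasFirstMoment_law hB hμ₀ n
  have hν' := hA.hasFirstMoment_law hB hμ₀ (n + 1)
  have hV : Measurable V := measurable_pi_lambda _ fun i => hε n i
  have hXm : Measurable fun ω i => X₀ i ω := measurable_pi_lambda _ hX₀
  have hεm : Measurable fun ω k i => ε k i ω :=
    measurable_pi_lambda _ fun k => measurable_pi_lambda _ fun i => hε k i
  have hU : Measurable U := (M.measurable_particles n).comp (hXm.prodMk hεm)
  have hUV : IndepFun U V P := M.indepFun_particles_noise hX₀ hε hindep hX₀ε n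
  have hVQ : P.map V = Q := M.map_noise_eq_pi hε hlaw hindep n
  have hjoint := (indepFun_iff_map_prod_eq_prod_map_map hU.aemeasurable hV.aemeasurable).1 hUV
  rw [hVQ] at hjoint
  set F : (Fin N → E d) × (Fin N → E m) → ℝ≥0∞ := fun p =>
    W1 (empirical fun i => M.step (p.1 i) (empirical p.1) (p.2 i)) (M.law μ₀ (n + 1)) with hF_def
  have hF : Measurable F := (measurable_W1_empirical hν').comp M.measurable_step_particle
  have hWU : Measurable fun ω => W1 (empirical (U ω)) (M.law μ₀ n) :=
    (measurable_W1_empirical hν).comp hU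
  have hprob := Measure.isProbabilityMeasure_map (μ := P) hU.aemeasurable
  calc _ = ∫⁻ ω, F (U ω, V ω) ∂P := rfl
    _ = ∫⁻ p, F p ∂((P.map U).prod Q) := by
        rw [← hjoint, lintegral_map hF (hU.prodMk hV)]
    -- By independence the noise can be integrated first with the state `U ω` held fixed, which is
    -- the setting of the deterministic estimate.
    _ = ∫⁻ ω, ∫⁻ z, F (U ω, z) ∂Q ∂P := by
        rw [lintegral_prod _ hF.aemeasurable, lintegral_map hF.lintegral_prod_right' hU]
    _ ≤ ∫⁻ ω, (4 * M.lipConst * W1 (empirical (U ω)) (M.law μ₀ n) +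
          (2 * η + (∑ k ∈ q.range, ‖k‖ₑ) * (((N : ℕ) : ℝ≥0∞)⁻¹) ^ (1 / 2 : ℝ))) ∂P :=
        lintegral_mono fun ω => hA.lintegral_W1_step_le hν hlip hq (U ω)
    _ = _ := by
        rw [lintegral_add_left (hWU.const_mul _), lintegral_const_mul _ hWU, lintegral_const,
          measure_univ, mul_one]

end Model

theorem tendsto_inv_natCast_rpow_half :
    Tendsto (fun N : ℕ+ => (((N : ℕ) : ℝ≥0∞)⁻¹) ^ (1 / 2 : ℝ)) atTop (𝓝 0) := by
  have h : Tendsto (fun N : ℕ+ => ((N : ℕ) : ℝ≥0∞)⁻¹) atTop (𝓝 0) :=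
    ENNReal.tendsto_inv_nat_nhds_zero.comp tendsto_PNat_val_atTop_atTop
  simpa using h.ennrpow_const (1 / 2 : ℝ)

end WeaklyInteracting

theorem theorem3p1 {d m : ℕ} (M : Model d m) (hA : M.AssumptionA) (hB : M.AssumptionB)
    (μ₀ : ProbabilityMeasure (E d)) (hμ₀ : HasFirstMoment μ₀)
    {Ω : ℕ+ → Type*} [∀ N, MeasurableSpace (Ω N)]
    (P : ∀ N, Measure (Ω N)) [∀ N, IsProbabilityMeasure (P N)]
    -- initial positions `X_0^{i,N}`, exchangeable with common law `μ₀`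
    (X₀ : ∀ N : ℕ+, Fin N → Ω N → E d)
    (hX₀_meas : ∀ N i, Measurable (X₀ N i))
    (hX₀_exch : ∀ N, Exchangeable (X₀ N) (P N))
    (hX₀_law : ∀ N i, (P N).map (X₀ N i) = μ₀)
    -- noise, with `ε N n i` standing for `ε_{n+1}^i`: i.i.d. with law `θ`, independent of `X_0`
    (ε : ∀ N : ℕ+, ℕ → Fin N → Ω N → E m)
    (hε_meas : ∀ N n i, Measurable (ε N n i))
    (hε_law : ∀ N n i, (P N).map (ε N n i) = M.θ)
    (hε_indep : ∀ N : ℕ+, iIndepFun (fun (p : ℕ × Fin N) => ε N p.1 p.2) (P N))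
    (hX₀ε : ∀ N : ℕ+, IndepFun (fun ω (i : Fin N) => X₀ N i ω)
      (fun ω (p : ℕ × Fin N) => ε N p.1 p.2 ω) (P N))
    (h₀ : Tendsto (fun N : ℕ+ => ∫⁻ ω, W1 (empirical fun i => X₀ N i ω) μ₀ ∂(P N))
      atTop (𝓝 0)) :
    ∀ n : ℕ, Tendsto (fun N : ℕ+ => ∫⁻ ω,
        W1 (empirical (M.particles (fun i => X₀ N i ω) (fun k i => ε N k i ω) n))
          (M.law μ₀ n) ∂(P N))
      atTop (𝓝 0) := by
  intro n
  induction n with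
  | zero => exact h₀
  | succ n ih =>
    rw [ENNReal.tendsto_nhds_zero]
    intro η hη
    have hη4 : 0 < η / 4 := ENNReal.div_pos hη.ne' (by norm_num)
    have hη2 : 0 < η / 2 := ENNReal.div_pos hη.ne' (by norm_num)
    -- The quantizer depends only on the limit law and on `η`, not on `N`, so its finite sum of
    -- norms is a constant in the limit. Its error enters doubled and uses half of `η`.
    obtain ⟨q, hlip, hq⟩ := exists_quantizer (hA.hasFirstMoment_law hB hμ₀ (n + 1)) hη4
    have hlim : Tendsto (fun N : ℕ+ => 4 * M.lipConst * ∫⁻ ω,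
        W1 (empirical (M.particles (fun i => X₀ N i ω) (fun k i => ε N k i ω) n))
          (M.law μ₀ n) ∂(P N) +
        (∑ k ∈ q.range, ‖k‖ₑ) * (((N : ℕ) : ℝ≥0∞)⁻¹) ^ (1 / 2 : ℝ)) atTop (𝓝 0) := by
      have h₁ := ENNReal.Tendsto.const_mul (a := 4 * M.lipConst) ih
        (Or.inr (ENNReal.mul_ne_top (by norm_num) hA.lipConst_ne_top))
      have h₂ := ENNReal.Tendsto.const_mul (a := ∑ k ∈ q.range, ‖k‖ₑ)
        tendsto_inv_natCast_rpow_half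
        (Or.inr (ENNReal.sum_lt_top.2 fun k _ => enorm_lt_top).ne)
      simpa using h₁.add h₂
    filter_upwards [(tendsto_order.1 hlim).2 _ hη2] with N hN
    refine (hA.lintegral_W1_particles_succ_le hB hμ₀ (hX₀_meas N) (hε_meas N) (hε_law N)
      (hε_indep N) (hX₀ε N) n hlip hq).trans ?_
    rw [add_left_comm]
    refine (add_le_add le_rfl hN.le).trans_eq ?_
    have h24 : 2 * (η / 4) = η / 2 := by
      rw [← mul_div_assoc, mul_comm, ← ENNReal.mul_div_mul_right η 2 (c := 2) (by norm_num)
        (by norm_num)]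
      norm_num
    rw [h24, ENNReal.add_halves]
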